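/- Let $\Omega=(a,b)$ be a bounded open interval of $\mathbb R$, let $f\in \mathrm{BV}(\Omega)$ and let $w\in L^\infty(\Omega)$ with $w\ge 0$ a.e. For $u\in\mathrm{BV}(\Omega)$ let $Du$ denote the distributional derivative of $u$ (a finite signed Radon measure on $\Omega$), $|Du|$ its total variation measure, and $J_u=\{x\in\Omega:\ |Du|(\{x\})\neq 0\}$ its jump set. Let $u\in\mathrm{BV}(\Omega)$ be any solution of $$\min_{v\in \mathrm{BV}(\Omega)}\ \frac12\int_\Omega w\,(f-v)^2\,dx+|Dv|(\Omega).$$ Then $$J_u\cap \operatorname{supp}_{l,r}w\subseteq J_f,$$ where $\operatorname{supp}_{l,r}w$ is the set of all $x\in\Omega$ such that for every $\epsilon>0$ the function $w$ is not a.e. equal to zero on $(x-\epsilon,x)\cap\Omega$ and also not a.e. equal to zero on $(x,x+\epsilon)\cap\Omega$. In particular, if $w>0$ a.e. in $\Omega$, then $J_u\subseteq J_f$. -/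

import Mathlib

open Set MeasureTheory
open scoped ContDiff

noncomputable section

namespace WeightedFidelityTV

/-- The signed Borel measure `μ` lives on `Ω = (a, b)` (it vanishes on Borel sets that do not meet
`Ω`) and represents the distributional derivative of `u` on `Ω`:
`∫_Ω u φ' dx = - ∫_Ω φ dμ` for all `φ ∈ C_c^∞(Ω)`. A `SignedMeasure` is automatically finite. -/
def IsDistribDeriv (a b : ℝ) (u : ℝ → ℝ) (μ : SignedMeasure ℝ) : Prop :=
  (∀ s : Set ℝ, MeasurableSet s → Disjoint s (Ioo a b) → μ s = 0) ∧
    ∀ φ : ℝ → ℝ, ContDiff ℝ ∞ φ → HasCompactSupport φ → tsupport φ ⊆ Ioo a b →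
      ∫ x in Ioo a b, u x * deriv φ x = - ∫ᵛ x, φ x ∂<•μ

/-- `u ∈ BV((a, b))`: `u` is Lebesgue integrable on `(a, b)` and its distributional derivative
there is a finite signed Borel measure. Only the values of `u` on `(a, b)` matter, and only up to
a null set. -/
def IsBV (a b : ℝ) (u : ℝ → ℝ) : Prop :=
  IntegrableOn u (Ioo a b) ∧ ∃ μ : SignedMeasure ℝ, IsDistribDeriv a b u μ

open Classical in
/-- The derivative measure `Du` of `u ∈ BV((a, b))`, extended by zero outside of `(a, b)`
(and `0` by convention if `u` is not in `BV((a, b))`). -/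
def D (a b : ℝ) (u : ℝ → ℝ) : SignedMeasure ℝ :=
  if h : IsBV a b u then h.2.choose else 0

/-- The jump set `J_u = {x ∈ (a, b) : |Du|({x}) ≠ 0}`. -/
def jumpSet (a b : ℝ) (u : ℝ → ℝ) : Set ℝ :=
  {x | x ∈ Ioo a b ∧ (D a b u).totalVariation {x} ≠ 0}

/-- The functional `½ ∫_Ω w (f - u)² dx + |Du|(Ω)`, `Ω = (a, b)`. For `f, u ∈ BV((a, b))` and
`w ∈ L^∞((a, b))` the integrand is integrable, since `BV((a, b)) ⊆ L^∞((a, b))`. -/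
def energy (a b : ℝ) (f w u : ℝ → ℝ) : ℝ :=
  1 / 2 * (∫ x in Ioo a b, w x * (f x - u x) ^ 2) + (D a b u).totalVariation.real (Ioo a b)

/-- `u` is a solution of `min_{v ∈ BV((a, b))} ½ ∫_Ω w (f - v)² dx + |Dv|(Ω)`. -/
def IsSolution (a b : ℝ) (f w u : ℝ → ℝ) : Prop :=
  IsBV a b u ∧ ∀ v : ℝ → ℝ, IsBV a b v → energy a b f w u ≤ energy a b f w v

/-- The set of `x ∈ (a, b)` such that for every `ε > 0` the function `w` is not a.e. zero on
`(x - ε, x)` and not a.e. zero on `(x, x + ε)` (both intervals cut down to `(a, b)`, the domain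
of `w`). -/
def suppLR (a b : ℝ) (w : ℝ → ℝ) : Set ℝ :=
  {x | x ∈ Ioo a b ∧ ∀ ε : ℝ, 0 < ε →
    (¬ ∀ᵐ t ∂(volume.restrict (Ioo (x - ε) x ∩ Ioo a b)), w t = 0) ∧
    (¬ ∀ᵐ t ∂(volume.restrict (Ioo x (x + ε) ∩ Ioo a b)), w t = 0)}

end WeightedFidelityTV

end

namespace WeightedFidelityTV

open Filter Topology

/-! Suppose `u` jumps by `j ≠ 0` at `x₀` and `f` does not. Then `u - f` has one-sided limits `A`
(right) and `A - j` (left), so it cannot be small on both sides: either `j * A > 0`, or `j * (A - j)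
≤ -j ^ 2 < 0`. On the offending side, shift `u` by a small fraction `κ` of its jump, towards `f`, on
an interval ending at `x₀`. This moves mass `κ * |j|` of the derivative from `x₀` to the other
endpoint, so the total variation does not grow (`totalVariation_real_add_dirac_add_dirac_le`), while
the fit strictly improves wherever `w > 0`. By minimality `w` vanishes a.e. on that interval
(`IsSolution.ae_eq_zero_of_shift`), which `suppLR` forbids. The one-sided limits come from
representing a BV function a.e. by the distribution function of its derivative
(`IsDistribDeriv.exists_ae_eq`). -/

/-! ### Uniqueness of the distributional derivative. -/

lemma signedMeasure_eq_posPart_sub_negPart (σ : SignedMeasure ℝ) :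
    σ = σ.toJordanDecomposition.posPart.toSignedMeasure -
      σ.toJordanDecomposition.negPart.toSignedMeasure :=
  (σ.toSignedMeasure_toJordanDecomposition).symm

lemma integrable_of_contDiff {φ : ℝ → ℝ} (hφ : ContDiff ℝ ∞ φ) (hc : HasCompactSupport φ)
    (μ : Measure ℝ) [IsFiniteMeasure μ] : Integrable φ μ :=
  hφ.continuous.integrable_of_hasCompactSupport hc

lemma vectorMeasure_integrable_of_contDiff {φ : ℝ → ℝ} (hφ : ContDiff ℝ ∞ φ)
    (hc : HasCompactSupport φ) (σ : SignedMeasure ℝ) : σ.Integrable φ := by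
  have : IsFiniteMeasure σ.variation := by
    rw [← SignedMeasure.totalVariation_eq_variation]; infer_instance
  exact integrable_of_contDiff hφ hc _

lemma integral_eq_posPart_sub_negPart {φ : ℝ → ℝ} (hφ : ContDiff ℝ ∞ φ)
    (hc : HasCompactSupport φ) (σ : SignedMeasure ℝ) :
    ∫ᵛ x, φ x ∂<•σ = ∫ x, φ x ∂σ.toJordanDecomposition.posPart -
      ∫ x, φ x ∂σ.toJordanDecomposition.negPart := by
  conv_lhs => rw [signedMeasure_eq_posPart_sub_negPart σ]
  rw [VectorMeasure.integral_sub_vectorMeasure (vectorMeasure_integrable_of_contDiff hφ hc _)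
    (vectorMeasure_integrable_of_contDiff hφ hc _), VectorMeasure.integral_toSignedMeasure,
    VectorMeasure.integral_toSignedMeasure]

/-- A signed measure on an open set that annihilates all test functions is zero. -/
lemma signedMeasure_eq_zero_of_integral_contDiff_eq_zero {U : Set ℝ} (hU : IsOpen U)
    {σ : SignedMeasure ℝ} (hσ : ∀ s, MeasurableSet s → Disjoint s U → σ s = 0)
    (h : ∀ φ : ℝ → ℝ, ContDiff ℝ ∞ φ → HasCompactSupport φ → tsupport φ ⊆ U →
      ∫ᵛ x, φ x ∂<•σ = 0) : σ = 0 := by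
  classical
  obtain ⟨s, hs, hP, hN⟩ := σ.toJordanDecomposition.mutuallySingular
  set P := σ.toJordanDecomposition.posPart with hPdef
  set N := σ.toJordanDecomposition.negPart with hNdef
  set τ := σ.totalVariation with hτ
  have hτPN : τ = P + N := rfl
  have hPr : τ.restrict sᶜ = P := by
    rw [hτPN, Measure.restrict_add, Measure.restrict_eq_zero.2 hN, add_zero]
    exact Measure.restrict_eq_self_of_ae_mem (by rw [ae_iff]; simpa using hP)
  have hNr : τ.restrict s = N := by
    rw [hτPN, Measure.restrict_add, Measure.restrict_eq_zero.2 hP, zero_add]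
    exact Measure.restrict_eq_self_of_ae_mem (by rw [ae_iff]; exact hN)
  -- Polar decomposition: `g` is the density of `σ` with respect to `τ`. It never vanishes, so `g =
  -- 0` a.e. on `U` forces `τ U = 0`.
  let g : ℝ → ℝ := fun x => if x ∈ s then -1 else 1
  have hgm : Measurable g := Measurable.ite hs measurable_const measurable_const
  have hgi : Integrable g τ := by
    refine Integrable.of_bound (C := 1) hgm.aestronglyMeasurable (ae_of_all _ fun x => ?_)
    by_cases hx : x ∈ s <;> simp [g, hx]
  have hg0 : ∀ᵐ x ∂τ, x ∈ U → g x = 0 := by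
    refine hU.ae_eq_zero_of_integral_contDiff_smul_eq_zero
      (hgi.locallyIntegrable.locallyIntegrableOn U) fun φ hφ hc hφU => ?_
    have hφi : Integrable φ τ := integrable_of_contDiff hφ hc _
    have hi : Integrable (fun x => φ x • g x) τ := by
      refine hφi.mul_bdd (c := 1) hgm.aestronglyMeasurable (ae_of_all _ fun x => ?_)
      by_cases hx : x ∈ s <;> simp [g, hx]
    rw [← integral_add_compl hs hi,
      setIntegral_congr_fun hs (g := fun x => - φ x) (fun x hx => by simp [g, hx]),
      setIntegral_congr_fun hs.compl (g := φ)
        (fun x hx => by simp [g, (mem_compl_iff _ _).1 hx]), hPr, hNr, integral_neg,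
        neg_add_eq_sub, ← integral_eq_posPart_sub_negPart hφ hc, h φ hφ hc hφU]
  have hτU : τ U = 0 := by
    refine measure_mono_null (fun x hx => ?_) (ae_iff.1 hg0)
    by_cases hxs : x ∈ s <;> simp [g, hxs, hx]
  have hτUc : τ Uᶜ = 0 := by
    rw [hτ, SignedMeasure.totalVariation_eq_variation,
      VectorMeasure.variation_apply_eq_zero hU.measurableSet.compl]
    exact fun t ht htm => hσ t htm (disjoint_left.2 fun x hx hxU => ht hx hxU)
  have : τ = 0 := by
    rw [← Measure.measure_univ_eq_zero, ← union_compl_self U]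
    exact measure_union_null hτU hτUc
  rwa [hτ, SignedMeasure.totalVariation_eq_variation, VectorMeasure.variation_eq_zero] at this

lemma IsDistribDeriv.unique {a b : ℝ} {u : ℝ → ℝ} {μ ν : SignedMeasure ℝ}
    (hμ : IsDistribDeriv a b u μ) (hν : IsDistribDeriv a b u ν) : μ = ν := by
  rw [← sub_eq_zero]
  refine signedMeasure_eq_zero_of_integral_contDiff_eq_zero isOpen_Ioo (U := Ioo a b)
    (fun s hs hd => ?_) fun φ hφ hc hs => ?_
  · simp [hμ.1 s hs hd, hν.1 s hs hd]
  · rw [VectorMeasure.integral_sub_vectorMeasure (vectorMeasure_integrable_of_contDiff hφ hc _)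
      (vectorMeasure_integrable_of_contDiff hφ hc _)]
    linarith [hμ.2 φ hφ hc hs, hν.2 φ hφ hc hs]

lemma IsBV.isDistribDeriv {a b : ℝ} {u : ℝ → ℝ} (hu : IsBV a b u) :
    IsDistribDeriv a b u (D a b u) := by
  rw [D, dif_pos hu]; exact hu.2.choose_spec

/-- Since `D` is a choice, uniqueness is what allows the energy of a competitor to be computed from
an explicit measure. -/
lemma IsDistribDeriv.D_eq {a b : ℝ} {u : ℝ → ℝ} {μ : SignedMeasure ℝ}
    (hu : IntegrableOn u (Ioo a b)) (hμ : IsDistribDeriv a b u μ) : D a b u = μ :=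
  IsBV.isDistribDeriv ⟨hu, μ, hμ⟩ |>.unique hμ

/-! ### BV functions as distribution functions. -/

/-- Integration by parts for the distribution function of a finite measure. -/
lemma integral_measureReal_Iic_mul_deriv {a b : ℝ} (P : Measure ℝ) [IsFiniteMeasure P]
    {φ : ℝ → ℝ} (hφ : ContDiff ℝ ∞ φ) (hc : HasCompactSupport φ) (hs : tsupport φ ⊆ Ioo a b) :
    ∫ x in Ioo a b, P.real (Iic x) * deriv φ x = - ∫ x, φ x ∂P := by
  have hd : Continuous (deriv φ) := hφ.continuous_deriv (by simp)
  have hdi : Integrable (deriv φ) := hd.integrable_of_hasCompactSupport hc.deriv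
  have h1 : ∫ x in Ioo a b, P.real (Iic x) * deriv φ x = ∫ x, P.real (Iic x) * deriv φ x := by
    refine setIntegral_eq_integral_of_forall_compl_eq_zero fun x hx => ?_
    rw [image_eq_zero_of_notMem_tsupport (f := deriv φ)
      (fun hx' => hx (hs (tsupport_deriv_subset (𝕜 := ℝ) hx'))), mul_zero]
  have hT : MeasurableSet {z : ℝ × ℝ | z.2 ≤ z.1} := measurableSet_le measurable_snd measurable_fst
  -- Fubini on the half-plane `y ≤ x`: integrating in `y` gives the left side, integrating in `x`
  -- gives `-φ y`.
  have h2 : ∀ x, P.real (Iic x) * deriv φ x =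
      ∫ y, {z : ℝ × ℝ | z.2 ≤ z.1}.indicator (fun z => deriv φ z.1) (x, y) ∂P := by
    intro x
    have : (fun y => {z : ℝ × ℝ | z.2 ≤ z.1}.indicator (fun z => deriv φ z.1) (x, y)) =
        (Iic x).indicator fun _ => deriv φ x := by
      ext y; by_cases hy : y ≤ x <;> simp [hy]
    rw [this, integral_indicator measurableSet_Iic, setIntegral_const, smul_eq_mul]
  have h3 : ∀ y, ∫ x, {z : ℝ × ℝ | z.2 ≤ z.1}.indicator (fun z => deriv φ z.1) (x, y) = - φ y := by
    intro y
    have : (fun x => {z : ℝ × ℝ | z.2 ≤ z.1}.indicator (fun z => deriv φ z.1) (x, y)) =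
        (Ici y).indicator (deriv φ) := by
      ext x; by_cases hy : y ≤ x <;> simp [hy]
    rw [this, integral_indicator measurableSet_Ici, integral_Ici_eq_integral_Ioi,
      hc.integral_Ioi_deriv_eq (hφ.of_le (by simp))]
  rw [h1, integral_congr_ae (ae_of_all _ h2), integral_integral_swap,
    integral_congr_ae (ae_of_all _ h3), integral_neg]
  exact (hdi.comp_fst P).indicator hT

lemma measurable_signedMeasure_Iic (σ : SignedMeasure ℝ) : Measurable fun x => σ (Iic x) := by
  have : (fun x => σ (Iic x)) = fun x => σ.toJordanDecomposition.posPart.real (Iic x) -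
      σ.toJordanDecomposition.negPart.real (Iic x) :=
    funext fun x => σ.apply_eq_posPart_real_sub_negPart_real measurableSet_Iic
  rw [this]
  refine Measurable.sub ?_ ?_ <;>
  exact Monotone.measurable fun x y hxy => measureReal_mono (Iic_subset_Iic.2 hxy)

lemma abs_signedMeasure_le (σ : SignedMeasure ℝ) (s : Set ℝ) :
    |σ s| ≤ σ.totalVariation.real univ :=
  (σ.norm_le_totalVariation s).trans (measureReal_mono (subset_univ _))

lemma integrableOn_signedMeasure_Iic (a b : ℝ) (σ : SignedMeasure ℝ) :
    IntegrableOn (fun x => σ (Iic x)) (Ioo a b) :=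
  Integrable.of_bound (measurable_signedMeasure_Iic σ).aestronglyMeasurable _
    (ae_of_all _ fun _ => abs_signedMeasure_le σ _)

lemma integral_signedMeasure_Iic_mul_deriv {a b : ℝ} (σ : SignedMeasure ℝ)
    {φ : ℝ → ℝ} (hφ : ContDiff ℝ ∞ φ) (hc : HasCompactSupport φ) (hs : tsupport φ ⊆ Ioo a b) :
    ∫ x in Ioo a b, σ (Iic x) * deriv φ x = - ∫ᵛ x, φ x ∂<•σ := by
  have hd : Continuous (deriv φ) := hφ.continuous_deriv (by simp)
  have hdi : Integrable (deriv φ) := hd.integrable_of_hasCompactSupport hc.deriv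
  have hi : ∀ (P : Measure ℝ) [IsFiniteMeasure P],
      IntegrableOn (fun x => P.real (Iic x) * deriv φ x) (Ioo a b) := by
    intro P _
    have hm : Measurable fun x => P.real (Iic x) :=
      Monotone.measurable fun x y hxy => measureReal_mono (Iic_subset_Iic.2 hxy)
    refine hdi.integrableOn.bdd_mul (c := P.real univ) hm.aestronglyMeasurable
      (ae_of_all _ fun x => ?_)
    rw [Real.norm_of_nonneg measureReal_nonneg]
    exact measureReal_mono (subset_univ _)
  rw [integral_eq_posPart_sub_negPart hφ hc, neg_sub, ← neg_sub_neg,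
    ← integral_measureReal_Iic_mul_deriv _ hφ hc hs, ← integral_measureReal_Iic_mul_deriv _ hφ hc hs,
    ← integral_sub (hi _) (hi _)]
  refine integral_congr_ae (ae_of_all _ fun x => ?_)
  simp only [σ.apply_eq_posPart_real_sub_negPart_real measurableSet_Iic]
  ring

/-- A test function with vanishing integral has a primitive that is a test function. -/
lemma exists_contDiff_deriv_eq {a b : ℝ} (hab : a < b) {ζ : ℝ → ℝ} (hζ : ContDiff ℝ ∞ ζ)
    (hc : HasCompactSupport ζ) (hs : tsupport ζ ⊆ Ioo a b) (h0 : ∫ x, ζ x = 0) :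
    ∃ Φ : ℝ → ℝ, ContDiff ℝ ∞ Φ ∧ HasCompactSupport Φ ∧ tsupport Φ ⊆ Ioo a b ∧ deriv Φ = ζ := by
  -- The margins keep the support of the primitive, contained in `Icc c d`, away from `a` and `b`.
  obtain ⟨c, d, hac, hdb, hcd⟩ : ∃ c d, a < c ∧ d < b ∧ tsupport ζ ⊆ Ioo c d := by
    rcases (tsupport ζ).eq_empty_or_nonempty with he | hne
    · exact ⟨(a + b) / 2, (a + b) / 2, by linarith, by linarith, by simp [he]⟩
    · have hi := hs (hc.isCompact.sInf_mem hne)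
      have hS := hs (hc.isCompact.sSup_mem hne)
      refine ⟨(a + sInf (tsupport ζ)) / 2, (sSup (tsupport ζ) + b) / 2, by linarith [hi.1],
        by linarith [hS.2], fun x hx => ⟨?_, ?_⟩⟩
      · linarith [hi.1, csInf_le hc.isCompact.bddBelow hx]
      · linarith [hS.2, le_csSup hc.isCompact.bddAbove hx]
  have hz : ∀ x, x ∉ Ioo c d → ζ x = 0 := fun x hx =>
    image_eq_zero_of_notMem_tsupport fun hx' => hx (hcd hx')
  have hder : ∀ x, HasDerivAt (fun x => ∫ t in c..x, ζ t) (ζ x) x := fun x =>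
    hζ.continuous.integral_hasStrictDerivAt c x |>.hasDerivAt
  have hderiv : deriv (fun x => ∫ t in c..x, ζ t) = ζ := funext fun x => (hder x).deriv
  have hsub : tsupport (fun x => ∫ t in c..x, ζ t) ⊆ Icc c d := by
    refine closure_minimal (fun x hx => ?_) isClosed_Icc
    by_contra hx'
    refine hx ?_
    rcases lt_or_ge x c with hxc | hxc
    · refine (intervalIntegral.integral_congr (g := fun _ => 0) fun t ht => hz t fun ht' => ?_).trans
        (by simp)
      rw [uIcc_of_ge hxc.le] at ht
      exact absurd ht'.1 (not_lt.2 ht.2)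
    · have hdx : d < x := by
        by_contra! h
        exact hx' ⟨hxc, h⟩
      simp only
      rw [intervalIntegral.integral_eq_integral_of_support_subset, h0]
      intro t ht
      have : t ∈ Ioo c d := by
        by_contra h
        exact ht (hz t h)
      exact ⟨this.1, (this.2.trans hdx).le⟩
  refine ⟨_, ?_, isCompact_Icc.of_isClosed_subset (isClosed_tsupport _) hsub, fun x hx => ?_, hderiv⟩
  · rw [contDiff_infty_iff_deriv, hderiv]
    exact ⟨fun x => (hder x).differentiableAt, hζ⟩
  · exact ⟨hac.trans_le (hsub hx).1, (hsub hx).2.trans_lt hdb⟩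

/-- The lemma of du Bois-Reymond. -/
lemma exists_ae_eq_const_of_integral_mul_deriv_eq_zero {a b : ℝ} (hab : a < b) {h : ℝ → ℝ}
    (hi : IntegrableOn h (Ioo a b))
    (h0 : ∀ φ : ℝ → ℝ, ContDiff ℝ ∞ φ → HasCompactSupport φ → tsupport φ ⊆ Ioo a b →
      ∫ x in Ioo a b, h x * deriv φ x = 0) :
    ∃ c, ∀ᵐ x ∂volume.restrict (Ioo a b), h x = c := by
  obtain ⟨ρ, hρs, hρc, hρ, hρr, hρ1⟩ := exists_contDiff_tsupport_subset (n := ⊤)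
    (Ioo_mem_nhds (show a < (a + b) / 2 by linarith) (show (a + b) / 2 < b by linarith))
  have hρpos : 0 < ∫ x, ρ x :=
    hρ.continuous.integral_pos_of_hasCompactSupport_nonneg_nonzero hρc
      (fun y => (hρr ⟨y, rfl⟩).1) (x := (a + b) / 2) (by simp [hρ1])
  set I := ∫ x, ρ x with hI
  have hmul : ∀ φ : ℝ → ℝ, ContDiff ℝ ∞ φ → HasCompactSupport φ →
      IntegrableOn (fun x => h x * φ x) (Ioo a b) := by
    intro φ hφ hc
    obtain ⟨C, hC⟩ := hc.exists_bound_of_continuous hφ.continuous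
    exact hi.mul_bdd (c := C) hφ.continuous.aestronglyMeasurable (ae_of_all _ hC)
  refine ⟨(∫ x in Ioo a b, h x * ρ x) / I, ?_⟩
  set c := (∫ x in Ioo a b, h x * ρ x) / I with hcdef
  have hkey : ∀ᵐ x ∂volume.restrict (Ioo a b), x ∈ Ioo a b → h x - c = 0 := by
    refine isOpen_Ioo.ae_eq_zero_of_integral_contDiff_smul_eq_zero
      ((hi.sub (integrable_const c)).locallyIntegrable.locallyIntegrableOn _)
      fun ψ hψ hψc hψs => ?_
    set J := ∫ x, ψ x with hJ
    have hψi : Integrable ψ := hψ.continuous.integrable_of_hasCompactSupport hψc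
    have hρi : Integrable ρ := hρ.continuous.integrable_of_hasCompactSupport hρc
    -- Subtracting a multiple of the fixed bump `ρ` makes the integral of `ψ` vanish.
    obtain ⟨Φ, hΦ, hΦc, hΦs, hΦd⟩ := exists_contDiff_deriv_eq hab
      (ζ := fun x => ψ x - (J / I) * ρ x) (hψ.sub (contDiff_const.mul hρ))
      (hψc.sub (hρc.mul_left (f := fun _ => J / I)))
      ((tsupport_sub _ _).trans (union_subset hψs
        ((tsupport_mul_subset_right (f := fun _ => J / I)).trans hρs)))
      (by rw [integral_sub hψi (hρi.const_mul _), integral_const_mul, ← hI, ← hJ]; field_simp; ring)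
    have h1 := h0 Φ hΦ hΦc hΦs
    rw [hΦd] at h1
    have h2 : ∫ x in Ioo a b, ψ x = J :=
      setIntegral_eq_integral_of_forall_compl_eq_zero fun x hx =>
        image_eq_zero_of_notMem_tsupport fun hx' => hx (hψs hx')
    have e1 : ∀ x, h x * (ψ x - J / I * ρ x) = h x * ψ x - J / I * (h x * ρ x) := fun x => by ring
    have e2 : ∀ x, ψ x • (h x - c) = h x * ψ x - c * ψ x := fun x => by
      rw [smul_eq_mul]; ring
    simp only [e1] at h1
    rw [integral_sub (hmul ψ hψ hψc) ((hmul ρ hρ hρc).const_mul _), integral_const_mul] at h1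
    simp only [e2]
    rw [integral_sub (hmul ψ hψ hψc) (hψi.integrableOn.const_mul _), integral_const_mul, h2, hcdef]
    rw [← h1]; ring
  filter_upwards [hkey, ae_restrict_mem measurableSet_Ioo] with x hx hxm
  linarith [hx hxm]

/-- A function of bounded variation agrees a.e. with the distribution function of its derivative,
up to a constant. -/
lemma IsDistribDeriv.exists_ae_eq {a b : ℝ} (hab : a < b) {u : ℝ → ℝ} {μ : SignedMeasure ℝ}
    (hu : IntegrableOn u (Ioo a b)) (hμ : IsDistribDeriv a b u μ) :
    ∃ c, ∀ᵐ x ∂volume.restrict (Ioo a b), u x = c + μ (Iic x) := by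
  obtain ⟨c, hc⟩ := exists_ae_eq_const_of_integral_mul_deriv_eq_zero hab
    (h := fun x => u x - μ (Iic x)) (hu.sub (integrableOn_signedMeasure_Iic a b μ))
    fun φ hφ hφc hφs => by
      have hmul : ∀ v : ℝ → ℝ, IntegrableOn v (Ioo a b) →
          IntegrableOn (fun x => v x * deriv φ x) (Ioo a b) := by
        intro v hv
        have hd : Continuous (deriv φ) := hφ.continuous_deriv (by simp)
        obtain ⟨C, hC⟩ := hφc.deriv.exists_bound_of_continuous hd
        exact hv.mul_bdd (c := C) hd.aestronglyMeasurable (ae_of_all _ hC)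
      simp only [sub_mul]
      rw [integral_sub (hmul _ hu) (hmul _ (integrableOn_signedMeasure_Iic a b μ)), hμ.2 φ hφ hφc hφs,
        integral_signedMeasure_Iic_mul_deriv μ hφ hφc hφs, sub_self]
  exact ⟨c, hc.mono fun x hx => by linarith⟩

/-! ### Total variation after moving part of an atom. -/

/-- Only the atom at `p` must be tracked exactly; by subadditivity the new mass at `q` costs at most
`|r'|`, whatever `μ` does there. -/
lemma totalVariation_real_add_dirac_add_dirac_le (μ : SignedMeasure ℝ) {s : Set ℝ}
    (hs : MeasurableSet s) {p : ℝ} (hp : p ∈ s) (q r r' : ℝ) (h : |μ {p} + r| + |r'| ≤ |μ {p}|) :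
    (μ + VectorMeasure.dirac p r + VectorMeasure.dirac q r').totalVariation.real s ≤
      μ.totalVariation.real s := by
  have hsplit : μ + VectorMeasure.dirac p r + VectorMeasure.dirac q r' =
      VectorMeasure.dirac p (μ {p} + r) + μ.restrict {p}ᶜ + VectorMeasure.dirac q r' := by
    have h1 : VectorMeasure.dirac p (μ {p} + r) =
        VectorMeasure.dirac p (μ {p}) + (VectorMeasure.dirac p r : SignedMeasure ℝ) := by
      ext t ht
      by_cases hpt : p ∈ t <;> simp [ht, hpt]
    conv_lhs => rw [← μ.restrict_add_restrict_compl (measurableSet_singleton p),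
      VectorMeasure.restrict_singleton]
    rw [h1]
    abel
  have hle : (μ + VectorMeasure.dirac p r + VectorMeasure.dirac q r').totalVariation s ≤
      ENNReal.ofReal (|μ {p} + r| + μ.totalVariation.real (s \ {p}) + |r'|) := by
    rw [hsplit, SignedMeasure.totalVariation_eq_variation]
    refine (VectorMeasure.variation_add_le s).trans ?_
    rw [Measure.add_apply, ENNReal.ofReal_add (by positivity) (by positivity),
      ENNReal.ofReal_add (by positivity) (by positivity)]
    refine add_le_add ((VectorMeasure.variation_add_le s).trans ?_) ?_
    · rw [Measure.add_apply]
      refine add_le_add ?_ ?_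
      · rw [VectorMeasure.variation_dirac, Measure.smul_apply, Measure.dirac_apply_of_mem hp,
          smul_eq_mul, mul_one, Real.enorm_eq_ofReal_abs]
      · rw [VectorMeasure.variation_restrict (measurableSet_singleton p).compl,
          Measure.restrict_apply hs, ← SignedMeasure.totalVariation_eq_variation, ofReal_measureReal,
          sdiff_eq]
    · rw [VectorMeasure.variation_dirac, Measure.smul_apply, smul_eq_mul,
        Real.enorm_eq_ofReal_abs]
      exact mul_le_of_le_one_right' prob_le_one
  have hreal := ENNReal.toReal_le_of_le_ofReal (by positivity) hle
  have hdiff : μ.totalVariation.real (s \ {p}) =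
      μ.totalVariation.real s - μ.totalVariation.real {p} :=
    measureReal_sdiff (singleton_subset_iff.2 hp) (measurableSet_singleton p)
  have hsing := μ.norm_le_totalVariation {p}
  rw [Real.norm_eq_abs] at hsing
  rw [measureReal_def]
  linarith

/-! ### One-sided limits and atoms. -/

lemma tendsto_signedMeasure_of_eventually_mem_iff (σ : SignedMeasure ℝ) {l : Filter ℝ}
    [l.IsCountablyGenerated] {A : ℝ → Set ℝ} {B : Set ℝ} (hA : ∀ x, MeasurableSet (A x))
    (hB : MeasurableSet B) (h : ∀ y, ∀ᶠ x in l, y ∈ A x ↔ y ∈ B) :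
    Tendsto (fun x => σ (A x)) l (𝓝 (σ B)) := by
  have hm : ∀ (P : Measure ℝ) [IsFiniteMeasure P],
      Tendsto (fun x => P.real (A x)) l (𝓝 (P.real B)) := fun P _ =>
    (ENNReal.tendsto_toReal (measure_ne_top P B)).comp
      (tendsto_measure_of_tendsto_indicator_of_isFiniteMeasure l P hA h)
  simp only [σ.apply_eq_posPart_real_sub_negPart_real, hA, hB]
  exact (hm _).sub (hm _)

lemma tendsto_signedMeasure_Iic_nhdsGT (σ : SignedMeasure ℝ) (x₀ : ℝ) :
    Tendsto (fun x => σ (Iic x)) (𝓝[>] x₀) (𝓝 (σ (Iic x₀))) := by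
  refine tendsto_signedMeasure_of_eventually_mem_iff σ (fun _ => measurableSet_Iic)
    measurableSet_Iic fun y => ?_
  rcases le_or_gt y x₀ with hy | hy
  · filter_upwards [self_mem_nhdsWithin] with x hx
    exact ⟨fun _ => hy, fun _ => hy.trans (mem_Ioi.1 hx).le⟩
  · filter_upwards [Ioo_mem_nhdsGT hy] with x hx
    exact ⟨fun h => absurd hx.2 (not_lt.2 h), fun h => absurd hy (not_lt.2 h)⟩

lemma tendsto_signedMeasure_Iic_nhdsLT (σ : SignedMeasure ℝ) (x₀ : ℝ) :
    Tendsto (fun x => σ (Iic x)) (𝓝[<] x₀) (𝓝 (σ (Iic x₀) - σ {x₀})) := by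
  have : σ (Iic x₀) - σ {x₀} = σ (Iio x₀) := by
    rw [← Iio_union_right, VectorMeasure.of_union (by simp) measurableSet_Iio
      (measurableSet_singleton x₀), add_sub_cancel_right]
  rw [this]
  refine tendsto_signedMeasure_of_eventually_mem_iff σ (fun _ => measurableSet_Iic)
    measurableSet_Iio fun y => ?_
  rcases lt_or_ge y x₀ with hy | hy
  · filter_upwards [Ioo_mem_nhdsLT hy] with x hx
    exact ⟨fun _ => hy, fun _ => hx.1.le⟩
  · filter_upwards [self_mem_nhdsWithin] with x hx
    exact ⟨fun h => absurd (h.trans_lt (mem_Iio.1 hx)) (not_lt.2 hy), fun h => absurd h (not_lt.2 hy)⟩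

lemma totalVariation_singleton_eq_zero_iff (σ : SignedMeasure ℝ) (x : ℝ) :
    σ.totalVariation {x} = 0 ↔ σ {x} = 0 := by
  rw [SignedMeasure.totalVariation_eq_variation,
    VectorMeasure.variation_apply_eq_zero (measurableSet_singleton x)]
  refine ⟨fun h => h _ subset_rfl (measurableSet_singleton x), fun h t ht _ => ?_⟩
  rcases subset_singleton_iff_eq.1 ht with rfl | rfl
  · simp
  · exact h

/-! ### The shifted competitor. -/

/-- Adding a multiple of the indicator function of an interval adds two point masses to the
derivative. -/
lemma IsDistribDeriv.add_indicator_Ioo {a b p q : ℝ} {u : ℝ → ℝ} {μ : SignedMeasure ℝ}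
    (hu : IntegrableOn u (Ioo a b)) (hμ : IsDistribDeriv a b u μ) (hp : p ∈ Ioo a b)
    (hq : q ∈ Ioo a b) (hpq : p < q) (t : ℝ) :
    IsDistribDeriv a b (fun x => u x + (Ioo p q).indicator (fun _ => t) x)
      (μ + VectorMeasure.dirac p t + VectorMeasure.dirac q (-t)) := by
  refine ⟨fun s hs hd => ?_, fun φ hφ hc hsupp => ?_⟩
  · have hps : p ∉ s := fun h => disjoint_left.1 hd h hp
    have hqs : q ∉ s := fun h => disjoint_left.1 hd h hq
    simp [hμ.1 s hs hd, hps, hqs]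
  · have hd : Continuous (deriv φ) := hφ.continuous_deriv (by simp)
    obtain ⟨C, hC⟩ := hc.deriv.exists_bound_of_continuous hd
    have hdi : Integrable (deriv φ) := hd.integrable_of_hasCompactSupport hc.deriv
    have hi := vectorMeasure_integrable_of_contDiff hφ hc
    have hind : ∀ x, (Ioo p q).indicator (fun _ => t) x * deriv φ x =
        (Ioo p q).indicator (fun x => t * deriv φ x) x := fun x => by
      by_cases hx : x ∈ Ioo p q <;> simp [hx]
    have hftc : ∫ x in Ioo p q, deriv φ x = φ q - φ p := by
      rw [← integral_Ioc_eq_integral_Ioo, ← intervalIntegral.integral_of_le hpq.le]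
      exact intervalIntegral.integral_deriv_eq_sub
        (fun x _ => hφ.differentiable (by simp) x) (hd.intervalIntegrable _ _)
    simp only [add_mul, hind]
    rw [integral_add (hu.mul_bdd (c := C) hd.aestronglyMeasurable (ae_of_all _ hC))
      ((hdi.const_mul t).integrableOn.indicator measurableSet_Ioo), hμ.2 φ hφ hc hsupp,
      setIntegral_indicator measurableSet_Ioo,
      inter_eq_right.2 (Ioo_subset_Ioo hp.1.le hq.2.le), integral_const_mul, hftc,
      VectorMeasure.integral_add_vectorMeasure (hi _) (hi _),
      VectorMeasure.integral_add_vectorMeasure (hi _) (hi _), VectorMeasure.integral_dirac,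
      VectorMeasure.integral_dirac]
    simp only [ContinuousLinearMap.flip_apply, ContinuousLinearMap.lsmul_apply, smul_eq_mul]
    ring

/-- Boundedness makes the fidelity integrands integrable, so that the integrals in `energy` can be
compared. -/
lemma IsBV.memLp_top {a b : ℝ} (hab : a < b) {u : ℝ → ℝ} (hu : IsBV a b u) :
    MemLp u ⊤ (volume.restrict (Ioo a b)) := by
  obtain ⟨c, hc⟩ := hu.isDistribDeriv.exists_ae_eq hab hu.1
  refine memLp_top_of_bound hu.1.aestronglyMeasurable
    (|c| + (D a b u).totalVariation.real univ) (hc.mono fun x hx => ?_)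
  rw [hx]
  exact (abs_add_le _ _).trans (add_le_add le_rfl (abs_signedMeasure_le _ _))

lemma integrable_mul_sub_sq {a b : ℝ} {f w v : ℝ → ℝ}
    (hf : MemLp f ⊤ (volume.restrict (Ioo a b))) (hw : MemLp w ⊤ (volume.restrict (Ioo a b)))
    (hv : MemLp v ⊤ (volume.restrict (Ioo a b))) :
    IntegrableOn (fun x => w x * (f x - v x) ^ 2) (Ioo a b) := by
  have h1 : MemLp (fun x => (f x - v x) * (f x - v x)) ⊤ (volume.restrict (Ioo a b)) :=
    (hf.sub hv).mul (hf.sub hv)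
  have h2 : MemLp (fun x => w x * ((f x - v x) * (f x - v x))) ⊤ (volume.restrict (Ioo a b)) :=
    h1.mul hw
  simpa only [sq] using! h2.integrable le_top

/-- If shifting a solution by `t` on `(p, q)` does not increase the total variation and strictly
improves the fit to the data there, then the weight vanishes on `(p, q)`. -/
lemma IsSolution.ae_eq_zero_of_shift {a b : ℝ} (hab : a < b) {f w u : ℝ → ℝ} (hf : IsBV a b f)
    (hw : MemLp w ⊤ (volume.restrict (Ioo a b)))
    (hw0 : ∀ᵐ x ∂(volume.restrict (Ioo a b)), 0 ≤ w x) (hu : IsSolution a b f w u)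
    {p q t : ℝ} (hp : p ∈ Ioo a b) (hq : q ∈ Ioo a b) (hpq : p < q) (ht : t ≠ 0)
    (hTV : (D a b u + VectorMeasure.dirac p t + VectorMeasure.dirac q (-t)).totalVariation.real
      (Ioo a b) ≤ (D a b u).totalVariation.real (Ioo a b))
    (hfit : ∀ᵐ x ∂(volume.restrict (Ioo a b)), x ∈ Ioo p q → t * (u x - f x) ≤ -t ^ 2) :
    ∀ᵐ x ∂(volume.restrict (Ioo p q)), w x = 0 := by
  set v : ℝ → ℝ := fun x => u x + (Ioo p q).indicator (fun _ => t) x with hv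
  have hind : MemLp ((Ioo p q).indicator fun _ => t) ⊤ (volume.restrict (Ioo a b)) :=
    (memLp_const t).indicator measurableSet_Ioo
  have hvi : IntegrableOn v (Ioo a b) := hu.1.1.add (hind.integrable le_top)
  have hvd := hu.1.isDistribDeriv.add_indicator_Ioo hu.1.1 hp hq hpq t
  have hDv := hvd.D_eq hvi
  have hE := hu.2 v ⟨hvi, _, hvd⟩
  rw [energy, energy, hDv] at hE
  have hint : ∫ x in Ioo a b, w x * (f x - u x) ^ 2 ≤ ∫ x in Ioo a b, w x * (f x - v x) ^ 2 := by
    linarith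
  have hfm := hf.memLp_top hab
  have hum := hu.1.memLp_top hab
  have hiu := integrable_mul_sub_sq hfm hw hum
  have hiv := integrable_mul_sub_sq hfm hw (hum.add hind)
  have hwi : IntegrableOn ((Ioo p q).indicator w) (Ioo a b) :=
    (hw.integrable le_top).indicator measurableSet_Ioo
  have hle : ∫ x in Ioo a b, w x * (f x - v x) ^ 2 ≤
      ∫ x in Ioo a b, (w x * (f x - u x) ^ 2 - t ^ 2 * (Ioo p q).indicator w x) := by
    refine integral_mono_ae hiv (hiu.sub (hwi.const_mul _)) ?_
    filter_upwards [hw0, hfit] with x hx0 hx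
    by_cases hxI : x ∈ Ioo p q
    · simp only [hv, indicator_of_mem hxI]
      -- `(f - u - t)² = (f - u)² + 2t(u - f) + t²`, and the last two terms add up to at most `-t²`.
      nlinarith [mul_le_mul_of_nonneg_left (hx hxI) hx0]
    · simp [hv, indicator_of_notMem hxI]
  rw [integral_sub hiu (hwi.const_mul _), integral_const_mul] at hle
  have hsub : Ioo p q ⊆ Ioo a b := Ioo_subset_Ioo hp.1.le hq.2.le
  rw [setIntegral_indicator measurableSet_Ioo, inter_eq_right.2 hsub] at hle
  have hw0' : ∀ᵐ x ∂(volume.restrict (Ioo p q)), 0 ≤ w x :=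
    ae_restrict_of_ae_restrict_of_subset hsub hw0
  have hnn : 0 ≤ ∫ x in Ioo p q, w x := integral_nonneg_of_ae hw0'
  have hzero : ∫ x in Ioo p q, w x = 0 := by
    have : 0 < t ^ 2 := by positivity
    nlinarith
  exact (integral_eq_zero_iff_of_nonneg_ae hw0'
    (IntegrableOn.mono_set (hw.integrable le_top) hsub)).1 hzero

/-! ### The inclusion of jump sets. -/

lemma mem_jumpSet_iff {a b x : ℝ} {u : ℝ → ℝ} :
    x ∈ jumpSet a b u ↔ x ∈ Ioo a b ∧ D a b u {x} ≠ 0 :=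
  and_congr_right fun _ => (totalVariation_singleton_eq_zero_iff _ x).not

theorem IsSolution.jumpSet_inter_suppLR_subset {a b : ℝ} (hab : a < b) {f w u : ℝ → ℝ}
    (hf : IsBV a b f) (hw : MemLp w ⊤ (volume.restrict (Ioo a b)))
    (hw0 : ∀ᵐ x ∂(volume.restrict (Ioo a b)), 0 ≤ w x) (hu : IsSolution a b f w u) :
    jumpSet a b u ∩ suppLR a b w ⊆ jumpSet a b f := by
  rintro x₀ ⟨hJ, -, hsupp⟩
  obtain ⟨hx₀, hj⟩ := mem_jumpSet_iff.1 hJ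
  by_contra hJf
  have hjf : D a b f {x₀} = 0 := by
    by_contra h
    exact hJf (mem_jumpSet_iff.2 ⟨hx₀, h⟩)
  obtain ⟨cu, hcu⟩ := hu.1.isDistribDeriv.exists_ae_eq hab hu.1.1
  obtain ⟨cf, hcf⟩ := hf.isDistribDeriv.exists_ae_eq hab hf.1
  set j := D a b u {x₀} with hjdef
  set σ := D a b u - D a b f with hσ
  set A := cu - cf + σ (Iic x₀) with hA
  have hσj : σ {x₀} = j := by simp [hσ, hjf, hjdef]
  have hdiff : ∀ᵐ x ∂(volume.restrict (Ioo a b)), u x - f x = cu - cf + σ (Iic x) := by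
    filter_upwards [hcu, hcf] with x h1 h2
    rw [h1, h2, hσ, sub_apply]
    ring
  have hR : Tendsto (fun x => cu - cf + σ (Iic x)) (𝓝[>] x₀) (𝓝 A) :=
    (tendsto_signedMeasure_Iic_nhdsGT σ x₀).const_add _
  have hL : Tendsto (fun x => cu - cf + σ (Iic x)) (𝓝[<] x₀) (𝓝 (A - j)) := by
    rw [hA, add_sub_assoc, ← hσj]
    exact (tendsto_signedMeasure_Iic_nhdsLT σ x₀).const_add _
  have hj2 : 0 < j ^ 2 := by positivity
  have habs : ∀ κ, 0 < κ → κ ≤ 1 → |j + -(κ * j)| + |κ * j| ≤ |j| := by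
    intro κ h0 h1
    rw [show j + -(κ * j) = (1 - κ) * j by ring, abs_mul, abs_mul, abs_of_pos h0,
      abs_of_nonneg (sub_nonneg.2 h1)]
    linarith
  -- With `t = ∓κ * j`, the fit condition `t * (u - f) ≤ -t ^ 2` reads `κ * j ^ 2 ≤ ±j * (u - f)`;
  -- strictness at the limit passes to nearby points.
  have hκ : ∀ r, 0 < r → ∃ κ, 0 < κ ∧ κ ≤ 1 ∧ κ * j ^ 2 < r := by
    intro r hr
    refine ⟨min 1 (r / (2 * j ^ 2)), by positivity, min_le_left _ _, ?_⟩
    calc _ ≤ r / (2 * j ^ 2) * j ^ 2 := by gcongr; exact min_le_right _ _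
      _ = r / 2 := by field_simp
      _ < r := by linarith
  rcases lt_or_ge 0 (j * A) with hjA | hjA
  · obtain ⟨κ, h0, h1, h2⟩ := hκ _ hjA
    obtain ⟨y, hy, hsub⟩ := mem_nhdsGT_iff_exists_Ioo_subset.1
      (((hR.const_mul j).eventually (lt_mem_nhds h2)).and (Ioo_mem_nhdsGT hx₀.2))
    obtain ⟨q, hq₁, hq₂⟩ := exists_between (mem_Ioi.1 hy)
    have hqb : q < b := (hsub ⟨hq₁, hq₂⟩).2.2
    have hz := hu.ae_eq_zero_of_shift hab hf hw hw0 (p := x₀) (q := q) (t := -(κ * j)) hx₀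
      ⟨hx₀.1.trans hq₁, hqb⟩ hq₁ (neg_ne_zero.2 (mul_ne_zero h0.ne' hj))
      (totalVariation_real_add_dirac_add_dirac_le _ measurableSet_Ioo hx₀ _ _ _
        (by rw [neg_neg]; exact habs κ h0 h1)) (by
        filter_upwards [hdiff] with x hx hxI
        have := (hsub ⟨hxI.1, hxI.2.trans hq₂⟩).1
        rw [hx]
        nlinarith [mul_lt_mul_of_pos_left this h0])
    refine (hsupp (q - x₀) (sub_pos.2 hq₁)).2 (ae_restrict_of_ae_restrict_of_subset ?_ hz)
    rw [add_sub_cancel]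
    exact inter_subset_left
  · obtain ⟨κ, h0, h1, h2⟩ := hκ (-(j * (A - j))) (by nlinarith)
    obtain ⟨y, hy, hsub⟩ := mem_nhdsLT_iff_exists_Ioo_subset.1
      (((hL.const_mul j).eventually (gt_mem_nhds (lt_neg_of_lt_neg h2))).and
        (Ioo_mem_nhdsLT hx₀.1))
    obtain ⟨p, hp₁, hp₂⟩ := exists_between (mem_Iio.1 hy)
    have hap : a < p := (hsub ⟨hp₁, hp₂⟩).2.1
    have hz := hu.ae_eq_zero_of_shift hab hf hw hw0 (p := p) (q := x₀) (t := κ * j)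
      ⟨hap, hp₂.trans hx₀.2⟩ hx₀ hp₂ (mul_ne_zero h0.ne' hj)
      (by
        -- Here `x₀` is the right endpoint, so the atom being reduced is the one receiving `-t`.
        rw [add_right_comm]
        exact totalVariation_real_add_dirac_add_dirac_le _ measurableSet_Ioo hx₀ _ _ _
          (habs κ h0 h1)) (by
        filter_upwards [hdiff] with x hx hxI
        have := (hsub ⟨hp₁.trans hxI.1, hxI.2⟩).1
        rw [hx]
        nlinarith [mul_lt_mul_of_pos_left this h0])
    refine (hsupp (x₀ - p) (sub_pos.2 hp₂)).1 (ae_restrict_of_ae_restrict_of_subset ?_ hz)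
    rw [sub_sub_cancel]
    exact inter_subset_left

lemma not_ae_eq_zero_of_pos {a b c d : ℝ} {w : ℝ → ℝ}
    (hw : ∀ᵐ x ∂(volume.restrict (Ioo a b)), 0 < w x) (hcd : max c a < min d b) :
    ¬ ∀ᵐ t ∂(volume.restrict (Ioo c d ∩ Ioo a b)), w t = 0 := by
  intro h
  have hw' := ae_restrict_of_ae_restrict_of_subset (inter_subset_right (s := Ioo c d)) hw
  have hF : ∀ᵐ t ∂(volume.restrict (Ioo c d ∩ Ioo a b)), False := by
    filter_upwards [h, hw'] with t h1 h2
    exact h2.ne' h1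
  rw [eventually_false_iff_eq_bot, ae_eq_bot, Measure.restrict_eq_zero, Ioo_inter_Ioo,
    Real.volume_Ioo, ENNReal.ofReal_eq_zero] at hF
  exact absurd hcd (not_lt.2 (sub_nonpos.1 hF))

lemma suppLR_eq_Ioo {a b : ℝ} {w : ℝ → ℝ} (hw : ∀ᵐ x ∂(volume.restrict (Ioo a b)), 0 < w x) :
    suppLR a b w = Ioo a b := by
  refine Subset.antisymm (fun x hx => hx.1) fun x hx => ⟨hx, fun ε hε => ?_⟩
  obtain ⟨hax, hxb⟩ := hx
  constructor <;> refine not_ae_eq_zero_of_pos hw ?_ <;> simp only [max_lt_iff, lt_min_iff] <;>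
    refine ⟨⟨?_, ?_⟩, ?_, ?_⟩ <;> linarith

end WeightedFidelityTV

theorem proposition6p2 (a b : ℝ) (hab : a < b) (f w u : ℝ → ℝ)
    (hf : WeightedFidelityTV.IsBV a b f)
    (hw : MemLp w ⊤ (volume.restrict (Ioo a b)))
    (hw0 : ∀ᵐ x ∂(volume.restrict (Ioo a b)), 0 ≤ w x)
    (hu : WeightedFidelityTV.IsSolution a b f w u) :
    WeightedFidelityTV.jumpSet a b u ∩ WeightedFidelityTV.suppLR a b w ⊆
        WeightedFidelityTV.jumpSet a b f ∧
      ((∀ᵐ x ∂(volume.restrict (Ioo a b)), 0 < w x) →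
        WeightedFidelityTV.jumpSet a b u ⊆ WeightedFidelityTV.jumpSet a b f) := by
  have h := hu.jumpSet_inter_suppLR_subset hab hf hw hw0
  refine ⟨h, fun hpos x hx => h ⟨hx, ?_⟩⟩
  rw [WeightedFidelityTV.suppLR_eq_Ioo hpos]
  exact hx.1
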